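/- Fix an integer $p\ge 2$. For a simple undirected graph $G$ on $n$ vertices let $S_p(G)=\sum_{v}\binom{\deg v}{p}$ be its number of $p$-stars. A randomized algorithm knows $n$ and accesses $G$ only through an oracle for an adjacency-list representation of $G$ (in which every vertex has an ID in $\{1,\dots,n\}$ and its neighbors are listed in an arbitrary order), which answers three types of queries: a neighbor query $(v,i)$ returns the $i$-th neighbor of $v$, or $\bot$ if $i>\deg(v)$; a degree query $v$ returns $\deg(v)$; a random edge query returns an independent, uniformly random edge of $G$. Queries may be adaptive. For $\alpha\ge 1$, a number $x$ approximates $S$ to within the factor $\alpha$ if $S/\alpha\le x\le\alpha S$. Then any randomized algorithm which approximates $S_p$ to within a constant multiplicative factor with probability at least $2/3$ requires $\Omega\bigl(n^{p-1/p}/S_p^{1-1/p}\bigr)$ queries, for any $S_p=\Omega(n^p)$. Precisely: for all real $\alpha\ge1$ and $\kappa>0$ there are constants $C\ge1$, $c>0$ and $n_0$, depending only on $p$, $\alpha$ and $\kappa$, such that the following holds for all $n\ge n_0$ and all real $s$ with $\kappa n^p\le s\le n\binom{n-1}{p}$ (the right-hand side being the largest value of $S_p$ on $n$-vertex graphs).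 If a randomized algorithm, on every adjacency-list representation of every $n$-vertex graph $G$ with $s/C\le S_p(G)\le Cs$, with probability at least $2/3$ makes at most $q$ queries and outputs an approximation of $S_p(G)$ to within the factor $\alpha$, then $$q\;\ge\; c\,\frac{n^{p-1/p}}{s^{1-1/p}}.$$ -/

import Mathlib

open MeasureTheory
open scoped ENNReal

namespace StarCount

/-- The number `S_p(G)` of `p`-stars of `G`: a star consists of a center `v` together with a set `T`
of `p` distinct neighbors of `v`. -/
noncomputable def starCount {n : ℕ} (G : SimpleGraph (Fin n)) (p : ℕ) : ℕ :=
  {x : Fin n × Finset (Fin n) | x.2.card = p ∧ ∀ u ∈ x.2, G.Adj x.1 u}.ncard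

/-- `S_p = ∑ v, (deg v choose p)`. -/
theorem starCount_eq_sum {n : ℕ} (G : SimpleGraph (Fin n)) [DecidableRel G.Adj] (p : ℕ) :
    starCount G p = ∑ v, (G.degree v).choose p := by
  classical
  have h : {x : Fin n × Finset (Fin n) | x.2.card = p ∧ ∀ u ∈ x.2, G.Adj x.1 u} =
      ((Finset.univ.sigma fun v => (G.neighborFinset v).powersetCard p).map
        (Equiv.sigmaEquivProd (Fin n) (Finset (Fin n))).toEmbedding : Finset _) := by
    ext ⟨v, T⟩
    simp [Finset.mem_powersetCard, Finset.subset_iff, and_comm]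
  rw [starCount, h, Set.ncard_coe_finset, Finset.card_map, Finset.card_sigma]
  simp

/-- An input: a simple undirected graph on the vertex set `Fin n`, given by adjacency lists.
The order of the neighbors of a vertex in its list is arbitrary. -/
structure AdjList (n : ℕ) where
  graph : SimpleGraph (Fin n)
  nbr : Fin n → List (Fin n)
  nodup_nbr : ∀ v, (nbr v).Nodup
  mem_nbr : ∀ v w, w ∈ nbr v ↔ graph.Adj v w

/-- The queries. `neighbor v i` asks for the entry with (0-based) index `i` of the adjacency
list of `v`. -/
inductive Query (n : ℕ) where
  | neighbor (v : Fin n) (i : ℕ)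
  | degree (v : Fin n)
  | randomEdge

/-- The answers; `none` stands for `⊥`. -/
inductive Answer (n : ℕ) where
  | neighbor (w : Option (Fin n))
  | degree (d : ℕ)
  | edge (e : Option (Sym2 (Fin n)))

open Classical in
/-- The graph oracle: the distribution of its answer to a query. A neighbor query beyond the end of
the list is answered by `⊥`; a random edge query is answered by a uniformly random edge
(by `⊥` if there is no edge). Answers to successive queries are independent. -/
noncomputable def AdjList.answer {n : ℕ} (L : AdjList n) : Query n → PMF (Answer n)
  | .neighbor v i => PMF.pure (.neighbor (L.nbr v)[i]?)
  | .degree v => PMF.pure (.degree (L.graph.neighborSet v).ncard)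
  | .randomEdge =>
      if h : L.graph.edgeSet.toFinite.toFinset.Nonempty then
        (PMF.uniformOfFinset L.graph.edgeSet.toFinite.toFinset h).map fun e => .edge (some e)
      else PMF.pure (.edge none)

/-- A deterministic adaptive query algorithm on `n`-vertex graphs: given the list of the answers
received so far (most recent first), it either makes another query or stops with a real output. -/
abbrev DetAlg (n : ℕ) := List (Answer n) → Query n ⊕ ℝ

/-- The distribution of the output of `A` on the input `L`, when `A` has already received the
answers `h` and may make `q` more queries. The value is `none` if `A` asks for more queries. -/
noncomputable def DetAlg.output {n : ℕ} (A : DetAlg n) (L : AdjList n) :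
    ℕ → List (Answer n) → PMF (Option ℝ)
  | 0, h =>
      match A h with
      | .inl _ => PMF.pure none
      | .inr x => PMF.pure (some x)
  | q + 1, h =>
      match A h with
      | .inl Q => (L.answer Q).bind fun a => DetAlg.output A L q (a :: h)
      | .inr x => PMF.pure (some x)

/-- `x` approximates `S` to within the multiplicative factor `α`. -/
def Approximates (α S x : ℝ) : Prop := S / α ≤ x ∧ x ≤ α * S

/-- A randomized algorithm is a deterministic algorithm `A ω` depending on a random seed `ω`
of law `μ`. This is the probability, over the seed and the answers of the oracle, that on the input
`L` it makes at most `q` queries and its output approximates `S_p` to within the factor `α`.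
(If the dependence on the seed is not measurable, this is the lower integral.) -/
noncomputable def successProb {n : ℕ} {Ω : Type*} [MeasurableSpace Ω] (μ : Measure Ω)
    (A : Ω → DetAlg n) (q p : ℕ) (α : ℝ) (L : AdjList n) : ℝ≥0∞ :=
  ∫⁻ ω, ((A ω).output L q []).toOuterMeasure
    {o | ∃ x : ℝ, o = some x ∧ Approximates α (starCount L.graph p) x} ∂μ

end StarCount

namespace StarCount

/-! A few vertices of huge degree can dominate `S_p` and still be hard to find. Put `d =
(s/n)^(1/p)` and `σ = s/n^p`. With `N = n/3`, take a bipartite circulant graph on `N + N` vertices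
whose degree is a small multiple of `d`, so that it has few stars, and `N` isolated vertices.
Reroute the edges of `k ≈ σ` of the differences through `k` formerly isolated hubs of degree `2N`:
the other degrees do not change, but the hubs alone push `S_p` up by more than the factor `α ^ 2`.
Split the differences into `T ≈ d/σ` disjoint blocks of size `k`, each a possible choice of hubs. A
degree or neighbor query depends on one difference, so it can expose at most one block; a random
edge is new with probability at most `2/T`. Hence the advantages of a query, summed over the blocks,
are at most 2, and a hybrid argument (`sum_output_le`, `card_le_of_success`) gives `T ≤ 6 * q`
(`le_six_mul_queries`). The bound is `d/σ` rewritten (`rpow_bound_eq`); `exists_parameters` fixes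
the constants. -/

/-! ### Hybrid argument for adaptive algorithms. -/

theorem tsum_pmf_mul_le_one {β : Type*} (P : PMF β) {f : β → ℝ≥0∞} (hf : ∀ a, f a ≤ 1) :
    ∑' a, P a * f a ≤ 1 :=
  (ENNReal.tsum_le_tsum fun a => mul_le_of_le_one_right' (hf a)).trans P.tsum_coe.le

theorem toOuterMeasure_le_one {β : Type*} (P : PMF β) (s : Set β) : P.toOuterMeasure s ≤ 1 := by
  rw [PMF.toOuterMeasure_apply, ← P.tsum_coe]
  exact ENNReal.tsum_le_tsum fun a => Set.indicator_le_self _ _ _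

/-- The hybrid argument: if every query distinguishes `L₁` from a member of the family `L₂` only
with small advantage on average, then so does every algorithm making few queries. -/
theorem sum_output_le {n : ℕ} {ι : Type*} [Fintype ι] (A : DetAlg n) (L₁ : AdjList n)
    (L₂ : ι → AdjList n) (δ : Query n → ι → ℝ≥0∞) (ε : ℝ≥0∞)
    (hδ : ∀ Q t (f : Answer n → ℝ≥0∞), (∀ a, f a ≤ 1) →
      ∑' a, (L₂ t).answer Q a * f a ≤ ∑' a, L₁.answer Q a * f a + δ Q t)
    (hε : ∀ Q, ∑ t, δ Q t ≤ ε) (W : Set (Option ℝ)) (q : ℕ) (h : List (Answer n)) :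
    ∑ t, (A.output (L₂ t) q h).toOuterMeasure W ≤
      Fintype.card ι * (A.output L₁ q h).toOuterMeasure W + q * ε := by
  induction q generalizing h with
  | zero => cases hA : A h <;> simp [DetAlg.output, hA]
  | succ q ih =>
    cases hA : A h with
    | inr x => simp [DetAlg.output, hA]
    | inl Q =>
      simp only [DetAlg.output, hA, PMF.toOuterMeasure_bind_apply]
      -- Only the law of the current answer is exchanged, at cost `δ Q t`; the runs then share the
      -- same history, so induction applies for each answer.
      calc ∑ t, ∑' a, (L₂ t).answer Q a * (A.output (L₂ t) q (a :: h)).toOuterMeasure W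
          ≤ ∑ t, (∑' a, L₁.answer Q a * (A.output (L₂ t) q (a :: h)).toOuterMeasure W + δ Q t) :=
            Finset.sum_le_sum fun t _ => hδ Q t _ fun a => toOuterMeasure_le_one _ _
        _ = ∑' a, L₁.answer Q a * ∑ t, (A.output (L₂ t) q (a :: h)).toOuterMeasure W +
              ∑ t, δ Q t := by
            rw [Finset.sum_add_distrib, ← Summable.tsum_finsetSum fun _ _ => ENNReal.summable]
            simp only [Finset.mul_sum]
        _ ≤ ∑' a, L₁.answer Q a *
              (Fintype.card ι * (A.output L₁ q (a :: h)).toOuterMeasure W + q * ε) + ε := by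
            gcongr with a
            · exact ih _
            · exact hε Q
        _ = Fintype.card ι * ∑' a, L₁.answer Q a * (A.output L₁ q (a :: h)).toOuterMeasure W +
              (q + 1 : ℕ) * ε := by
            simp only [mul_add, ENNReal.tsum_add, ENNReal.tsum_mul_right, PMF.tsum_coe,
              mul_left_comm _ (Fintype.card ι : ℝ≥0∞), ENNReal.tsum_mul_left]
            push_cast
            ring

/-- The dependence on the seed may be non-measurable, and the lower integral is then only
superadditive, which is the direction needed. -/
theorem sum_lintegral_le {Ω ι : Type*} [MeasurableSpace Ω] (μ : Measure Ω) (s : Finset ι)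
    (f : ι → Ω → ℝ≥0∞) : ∑ i ∈ s, ∫⁻ ω, f i ω ∂μ ≤ ∫⁻ ω, ∑ i ∈ s, f i ω ∂μ := by
  classical
  induction s using Finset.induction_on with
  | empty => simp
  | insert i s hi ih =>
    simp only [Finset.sum_insert hi]
    exact (add_le_add le_rfl ih).trans (le_lintegral_add _ _)

/-- If an algorithm is correct on `L₁` and on every member of the family `L₂`, while the correct
outputs are disjoint, then it makes many queries. -/
theorem card_le_of_success {n : ℕ} {ι : Type*} [Fintype ι] {Ω : Type*} [MeasurableSpace Ω]
    (μ : Measure Ω) [IsProbabilityMeasure μ] (A : Ω → DetAlg n) (q p : ℕ) (α : ℝ)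
    (L₁ : AdjList n) (L₂ : ι → AdjList n) (δ : Query n → ι → ℝ≥0∞)
    (hδ : ∀ Q t (f : Answer n → ℝ≥0∞), (∀ a, f a ≤ 1) →
      ∑' a, (L₂ t).answer Q a * f a ≤ ∑' a, L₁.answer Q a * f a + δ Q t)
    (hε : ∀ Q, ∑ t, δ Q t ≤ 2) (S₂ : ℕ) (hS₂ : ∀ t, starCount (L₂ t).graph p = S₂)
    (hS : α * starCount L₁.graph p < S₂ / α)
    (h₁ : 2 / 3 ≤ successProb μ A q p α L₁) (h₂ : ∀ t, 2 / 3 ≤ successProb μ A q p α (L₂ t)) :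
    Fintype.card ι ≤ 6 * q := by
  set W₁ : Set (Option ℝ) := {o | ∃ x : ℝ, o = some x ∧ Approximates α (starCount L₁.graph p) x}
  set W₂ : Set (Option ℝ) := {o | ∃ x : ℝ, o = some x ∧ Approximates α S₂ x}
  have hdisj : ∀ P : PMF (Option ℝ), P.toOuterMeasure W₂ + P.toOuterMeasure W₁ ≤ 1 := by
    intro P
    rw [PMF.toOuterMeasure_apply, PMF.toOuterMeasure_apply, ← ENNReal.tsum_add, ← P.tsum_coe]
    refine ENNReal.tsum_le_tsum fun o => ?_
    by_cases h2 : o ∈ W₂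
    · have h1 : o ∉ W₁ := by
        rintro ⟨x, rfl, hx⟩
        obtain ⟨y, hy, hy'⟩ := h2
        obtain rfl : x = y := by simpa using hy
        linarith [hx.2, hy'.1]
      simp [h1, h2]
    · simpa [h2] using Set.indicator_le_self _ _ _
  -- After the outputs on `L₂ t` are compared with those on `L₁`, disjointness bounds the two
  -- success probabilities together by 1, up to the total advantage `2 * q`.
  have key : (Fintype.card ι : ℝ≥0∞) * (2 / 3 + 2 / 3) ≤ Fintype.card ι + q * 2 := by
    calc (Fintype.card ι : ℝ≥0∞) * (2 / 3 + 2 / 3)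
        = ∑ _t : ι, (2 / 3 + 2 / 3 : ℝ≥0∞) := by simp [mul_add]
      _ ≤ ∑ t, (successProb μ A q p α (L₂ t) + successProb μ A q p α L₁) :=
          Finset.sum_le_sum fun t _ => add_le_add (h₂ t) h₁
      _ ≤ ∑ t, ∫⁻ ω, (((A ω).output (L₂ t) q []).toOuterMeasure W₂ +
            ((A ω).output L₁ q []).toOuterMeasure W₁) ∂μ := by
          refine Finset.sum_le_sum fun t _ => ?_
          simp only [successProb, hS₂ t]
          exact le_lintegral_add _ _
      _ ≤ ∫⁻ ω, ∑ t, (((A ω).output (L₂ t) q []).toOuterMeasure W₂ +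
            ((A ω).output L₁ q []).toOuterMeasure W₁) ∂μ := sum_lintegral_le _ _ _
      _ ≤ ∫⁻ _, (Fintype.card ι + q * 2 : ℝ≥0∞) ∂μ := by
          refine lintegral_mono fun ω => ?_
          dsimp only
          rw [Finset.sum_add_distrib, Finset.sum_const, Finset.card_univ, nsmul_eq_mul]
          refine (add_le_add (sum_output_le (A ω) L₁ L₂ δ 2 hδ hε W₂ q []) le_rfl).trans ?_
          rw [add_right_comm, ← mul_add]
          gcongr
          exact mul_le_of_le_one_right' (hdisj _)
      _ = Fintype.card ι + q * 2 := by simp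
  have key' := ENNReal.toReal_mono (by finiteness) key
  rw [ENNReal.toReal_mul, ENNReal.toReal_add (by finiteness) (by finiteness),
    ENNReal.toReal_add (by finiteness) (by finiteness)] at key'
  simp at key'
  have : (Fintype.card ι : ℝ) ≤ 6 * q := by linarith
  exact_mod_cast this

/-! ### Advantage of a single query. -/

theorem tsum_map_mul {β γ : Type*} (P : PMF β) (g : β → γ) (f : γ → ℝ≥0∞) :
    ∑' c, P.map g c * f c = ∑' b, P b * f (g b) := by
  classical
  simp only [PMF.map_apply, ← ENNReal.tsum_mul_right]
  rw [ENNReal.tsum_comm]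
  refine tsum_congr fun b => ?_
  rw [tsum_eq_single (g b) fun c hc => by simp [hc]]
  simp

/-- On common elements the weight `1/|E₂|` is at most `1/|E₁|`, so only the elements new in `E₂` can
add anything. -/
theorem tsum_uniformOfFinset_mul_le {β : Type*} [DecidableEq β] {E₁ E₂ : Finset β}
    (h₁ : E₁.Nonempty) (h₂ : E₂.Nonempty) (h : E₁.card ≤ E₂.card) {f : β → ℝ≥0∞}
    (hf : ∀ e, f e ≤ 1) :
    ∑' e, PMF.uniformOfFinset E₂ h₂ e * f e ≤
      ∑' e, PMF.uniformOfFinset E₁ h₁ e * f e + (E₂ \ E₁).card / E₂.card := by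
  have hsum : (∑' e, (if e ∈ E₂ \ E₁ then (E₂.card : ℝ≥0∞)⁻¹ else 0)) =
      (E₂ \ E₁).card / E₂.card := by
    rw [tsum_eq_sum (s := E₂ \ E₁) fun e he => if_neg he, Finset.sum_ite_mem]
    simp [div_eq_mul_inv]
  rw [← hsum, ← ENNReal.tsum_add]
  refine ENNReal.tsum_le_tsum fun e => ?_
  rw [PMF.uniformOfFinset_apply, PMF.uniformOfFinset_apply]
  by_cases he₂ : e ∈ E₂
  · by_cases he₁ : e ∈ E₁
    · simp only [he₁, he₂, if_true, Finset.mem_sdiff, not_true, and_false, if_false, add_zero]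
      gcongr
    · simp only [he₁, he₂, if_true, if_false, Finset.mem_sdiff, not_false_eq_true, and_self,
        zero_mul, zero_add]
      exact mul_le_of_le_one_right' (hf e)
  · simp [he₂]

namespace AdjList

variable {n : ℕ}

theorem neighborSet_eq (L : AdjList n) (v : Fin n) :
    L.graph.neighborSet v = ((L.nbr v).toFinset : Set (Fin n)) := by
  ext w
  simp [L.mem_nbr]

theorem ncard_neighborSet (L : AdjList n) (v : Fin n) :
    (L.graph.neighborSet v).ncard = (L.nbr v).length := by
  rw [neighborSet_eq, Set.ncard_coe_finset, List.toFinset_card_of_nodup (L.nodup_nbr v)]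

theorem degree_eq (L : AdjList n) [DecidableRel L.graph.Adj] (v : Fin n) :
    L.graph.degree v = (L.nbr v).length := by
  rw [← ncard_neighborSet, Set.ncard_eq_toFinset_card', ← SimpleGraph.neighborFinset_def,
    SimpleGraph.card_neighborFinset_eq_degree]

theorem starCount_eq (L : AdjList n) (p : ℕ) :
    starCount L.graph p = ∑ v, (L.nbr v).length.choose p := by
  classical
  simp only [starCount_eq_sum, degree_eq]

theorem two_mul_card_edges (L : AdjList n) :
    2 * L.graph.edgeSet.toFinite.toFinset.card = ∑ v, (L.nbr v).length := by
  classical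
  have : L.graph.edgeSet.toFinite.toFinset = L.graph.edgeFinset := by
    ext e
    simp
  rw [this, ← SimpleGraph.sum_degrees_eq_twice_card_edges]
  simp only [degree_eq]

/-- The input with prescribed adjacency lists. -/
def ofNbr (nbr : Fin n → List (Fin n)) (nodup : ∀ v, (nbr v).Nodup)
    (symm : ∀ v w, w ∈ nbr v → v ∈ nbr w) (irrefl : ∀ v, v ∉ nbr v) : AdjList n where
  graph := { Adj := fun v w => w ∈ nbr v, symm := ⟨fun v w => symm v w⟩, loopless := ⟨irrefl⟩ }
  nbr := nbr
  nodup_nbr := nodup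
  mem_nbr _ _ := Iff.rfl

open Classical in
/-- An upper bound for the advantage with which a query distinguishes `L₂` from `L₁`. -/
noncomputable def advantage (L₁ L₂ : AdjList n) (ε : ℝ≥0∞) : Query n → ℝ≥0∞
  | .neighbor v i => if (L₂.nbr v)[i]? = (L₁.nbr v)[i]? then 0 else 1
  | .degree v => if (L₂.nbr v).length = (L₁.nbr v).length then 0 else 1
  | .randomEdge => ε

theorem tsum_answer_mul_le [DecidableEq (Sym2 (Fin n))] (L₁ L₂ : AdjList n)
    {E₁ E₂ : Finset (Sym2 (Fin n))} {ε : ℝ≥0∞}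
    (hE₁ : E₁ = L₁.graph.edgeSet.toFinite.toFinset)
    (hE₂ : E₂ = L₂.graph.edgeSet.toFinite.toFinset)
    (hne : E₁.Nonempty) (hcard : E₁.card ≤ E₂.card)
    (hε : ((E₂ \ E₁).card : ℝ≥0∞) / E₂.card ≤ ε) (Q : Query n) (f : Answer n → ℝ≥0∞)
    (hf : ∀ a, f a ≤ 1) :
    ∑' a, L₂.answer Q a * f a ≤ ∑' a, L₁.answer Q a * f a + advantage L₁ L₂ ε Q := by
  cases Q with
  | neighbor v i =>
    by_cases h : (L₂.nbr v)[i]? = (L₁.nbr v)[i]?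
    · simp [answer, h]
    · simp only [advantage, h, if_false]
      exact (tsum_pmf_mul_le_one _ hf).trans le_add_self
  | degree v =>
    by_cases h : (L₂.nbr v).length = (L₁.nbr v).length
    · simp [answer, h, ncard_neighborSet]
    · simp only [advantage, h, if_false]
      exact (tsum_pmf_mul_le_one _ hf).trans le_add_self
  | randomEdge =>
    subst hE₁ hE₂
    have hne₂ := Finset.card_pos.1 (hne.card_pos.trans_le hcard)
    simp only [answer, hne, hne₂, dif_pos, tsum_map_mul, advantage]
    exact (tsum_uniformOfFinset_mul_le hne hne₂ hcard fun _ => hf _).trans (by gcongr)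

end AdjList

/-! ### Circulant graphs with hidden hubs. -/

section Hub

variable {K : Type*} [Fintype K] [DecidableEq K] [AddGroup K]

/-- Adjacency lists on three copies of `K`. The first two copies carry the bipartite circulant graph
in which `i` is adjacent to `i + j` for `j` in `l`; for `j ∈ J` however the edges `{i, i + j}` are
replaced by paths of length two through the vertex `j` of the third copy, the hub. -/
noncomputable def hubList (l : List K) (J : Finset K) : K ⊕ K ⊕ K → List (K ⊕ K ⊕ K)
  | .inl i => l.map fun j => if j ∈ J then .inr (.inr j) else .inr (.inl (i + j))
  | .inr (.inl i) => l.map fun j => if j ∈ J then .inr (.inr j) else .inl (i - j)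
  | .inr (.inr j) =>
      if j ∈ J then
        (Finset.univ : Finset K).toList.map .inl ++
          (Finset.univ : Finset K).toList.map fun i => .inr (.inl i)
      else []

theorem hubList_nodup {l : List K} (hl : l.Nodup) (J : Finset K) (x : K ⊕ K ⊕ K) :
    (hubList l J x).Nodup := by
  rcases x with i | i | j
  · refine hl.map fun j j' h => ?_
    split_ifs at h <;> simp_all
  · refine hl.map fun j j' h => ?_
    split_ifs at h <;> simp_all
  · simp only [hubList]
    split_ifs
    · refine List.Nodup.append (Finset.univ.nodup_toList.map Sum.inl_injective)
        (Finset.univ.nodup_toList.map (Sum.inr_injective.comp Sum.inl_injective)) ?_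
      intro x hx hx'
      simp only [List.mem_map] at hx hx'
      obtain ⟨_, _, rfl⟩ := hx
      simp at hx'
    · exact List.nodup_nil

/-- For `j ∈ J` outside `l` the hub would list vertices that do not list it, hence the hypothesis
`hJ`. -/
theorem hubList_symm {l : List K} {J : Finset K} (hJ : ∀ j ∈ J, j ∈ l) {x y : K ⊕ K ⊕ K}
    (h : y ∈ hubList l J x) : x ∈ hubList l J y := by
  rcases x with i | i | j
  · simp only [hubList, List.mem_map] at h
    obtain ⟨j, hj, rfl⟩ := h
    by_cases hjJ : j ∈ J
    · simp [hubList, hjJ]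
    · simp only [hubList, hjJ, if_false, List.mem_map]
      exact ⟨j, hj, by simp [hjJ]⟩
  · simp only [hubList, List.mem_map] at h
    obtain ⟨j, hj, rfl⟩ := h
    by_cases hjJ : j ∈ J
    · simp [hubList, hjJ]
    · simp only [hubList, hjJ, if_false, List.mem_map]
      exact ⟨j, hj, by simp [hjJ]⟩
  · simp only [hubList] at h
    split_ifs at h with hjJ
    · simp only [List.mem_append, List.mem_map] at h
      rcases h with ⟨i, -, rfl⟩ | ⟨i, -, rfl⟩ <;>
        exact List.mem_map.2 ⟨j, hJ j hjJ, by simp [hjJ]⟩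
    · simp at h

theorem notMem_hubList (l : List K) (J : Finset K) (x : K ⊕ K ⊕ K) : x ∉ hubList l J x := by
  rcases x with i | i | j
  · simp only [hubList, List.mem_map, not_exists, not_and]
    intro j _
    split_ifs <;> simp
  · simp only [hubList, List.mem_map, not_exists, not_and]
    intro j _
    split_ifs <;> simp
  · simp only [hubList]
    split_ifs <;> simp

/-- Rerouting swaps one neighbor for another, so only hubs change degree. Used with `g` a binomial
coefficient for stars and `g = id` for edges. -/
theorem sum_length_hubList (l : List K) (J : Finset K) {g : ℕ → ℕ} (hg : g 0 = 0) :
    ∑ x, g (hubList l J x).length =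
      2 * Fintype.card K * g l.length + J.card * g (2 * Fintype.card K) := by
  have h : ∀ j, g (hubList l J (.inr (.inr j))).length =
      if j ∈ J then g (2 * Fintype.card K) else 0 := by
    intro j
    simp only [hubList]
    split_ifs <;> simp [hg, two_mul]
  simp only [Fintype.sum_sum_type, h, Finset.sum_ite_mem]
  simp [hubList]
  ring

/-- The slot `m` of an ordinary vertex is governed by the `m`-th difference in `l`, and the list of
a hub by its own index. For an empty slot any `j` serves. -/
theorem exists_getElem?_hubList_eq (l : List K) (x : K ⊕ K ⊕ K) (m : ℕ) :
    ∃ j, ∀ J : Finset K, j ∉ J → (hubList l J x)[m]? = (hubList l ∅ x)[m]? := by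
  rcases x with i | i | j
  · rcases h : l[m]? with _ | j
    · exact ⟨0, fun J _ => by simp [hubList, h]⟩
    · exact ⟨j, fun J hj => by simp [hubList, h, hj]⟩
  · rcases h : l[m]? with _ | j
    · exact ⟨0, fun J _ => by simp [hubList, h]⟩
    · exact ⟨j, fun J hj => by simp [hubList, h, hj]⟩
  · exact ⟨j, fun J hj => by simp [hubList, hj]⟩

theorem exists_length_hubList_eq (l : List K) (x : K ⊕ K ⊕ K) :
    ∃ j, ∀ J : Finset K, j ∉ J → (hubList l J x).length = (hubList l ∅ x).length := by
  rcases x with i | i | j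
  · exact ⟨0, fun J _ => by simp [hubList]⟩
  · exact ⟨0, fun J _ => by simp [hubList]⟩
  · exact ⟨j, fun J hj => by simp [hubList, hj]⟩

theorem hub_of_mem_of_notMem {l : List K} {J : Finset K} {x y : K ⊕ K ⊕ K}
    (h : y ∈ hubList l J x) (h' : y ∉ hubList l ∅ x) :
    ∃ j ∈ J, ∃ i : K ⊕ K, s(x, y) = s(.inr (.inr j), (Equiv.sumAssoc K K K) (.inl i)) := by
  rcases x with i | i | j
  · obtain ⟨j, hj, rfl⟩ := List.mem_map.1 h
    by_cases hjJ : j ∈ J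
    · exact ⟨j, hjJ, .inl i, by simp [hjJ]⟩
    · exact absurd (List.mem_map.2 ⟨j, hj, by simp [hjJ]⟩) h'
  · obtain ⟨j, hj, rfl⟩ := List.mem_map.1 h
    by_cases hjJ : j ∈ J
    · exact ⟨j, hjJ, .inr i, by simp [hjJ]⟩
    · exact absurd (List.mem_map.2 ⟨j, hj, by simp [hjJ]⟩) h'
  · simp only [hubList] at h
    split_ifs at h with hjJ
    · simp only [List.mem_append, List.mem_map] at h
      rcases h with ⟨i, -, rfl⟩ | ⟨i, -, rfl⟩
      · exact ⟨j, hjJ, .inl i, by simp⟩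
      · exact ⟨j, hjJ, .inr i, by simp⟩
    · simp at h

variable {n : ℕ} (f : K ⊕ K ⊕ K ↪ Fin n)

/-- `hubList` transported to `Fin n`, with isolated vertices outside of the range of `f`. -/
noncomputable def hubNbr (l : List K) (J : Finset K) : Fin n → List (Fin n) :=
  Function.extend f (fun x => (hubList l J x).map f) fun _ => []

theorem hubNbr_apply (l : List K) (J : Finset K) (x : K ⊕ K ⊕ K) :
    hubNbr f l J (f x) = (hubList l J x).map f :=
  f.injective.extend_apply _ _ _

theorem hubNbr_of_notMem_range (l : List K) (J : Finset K) {v : Fin n} (hv : ¬∃ x, f x = v) :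
    hubNbr f l J v = [] :=
  Function.extend_apply' _ _ _ hv

theorem mem_hubNbr {l : List K} {J : Finset K} {v w : Fin n} :
    w ∈ hubNbr f l J v ↔ ∃ x y, f x = v ∧ f y = w ∧ y ∈ hubList l J x := by
  by_cases hv : ∃ x, f x = v
  · obtain ⟨x, rfl⟩ := hv
    simp [hubNbr_apply, and_comm]
  · rw [hubNbr_of_notMem_range f l J hv]
    simp only [List.not_mem_nil, false_iff]
    rintro ⟨x, _, hx, -⟩
    exact hv ⟨x, hx⟩

/-- The input whose adjacency lists are given by `hubNbr`. -/
noncomputable def hubAdj {l : List K} (hl : l.Nodup) {J : Finset K} (hJ : ∀ j ∈ J, j ∈ l) :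
    AdjList n :=
  AdjList.ofNbr (hubNbr f l J)
    (fun v => by
      by_cases hv : ∃ x, f x = v
      · obtain ⟨x, rfl⟩ := hv
        rw [hubNbr_apply]
        exact (hubList_nodup hl J x).map f.injective
      · simp [hubNbr_of_notMem_range f l J hv])
    (fun v w h => by
      obtain ⟨x, y, rfl, rfl, hxy⟩ := (mem_hubNbr f).1 h
      exact (mem_hubNbr f).2 ⟨y, x, rfl, rfl, hubList_symm hJ hxy⟩)
    fun v h => by
      obtain ⟨x, y, rfl, hy, h⟩ := (mem_hubNbr f).1 h
      exact notMem_hubList l J x (f.injective hy ▸ h)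

theorem sum_length_hubNbr (l : List K) (J : Finset K) {g : ℕ → ℕ} (hg : g 0 = 0) :
    ∑ v, g (hubNbr f l J v).length =
      2 * Fintype.card K * g l.length + J.card * g (2 * Fintype.card K) := by
  rw [← sum_length_hubList l J hg, ← Finset.sum_subset (Finset.subset_univ (Finset.univ.map f))]
  · simp [hubNbr_apply]
  · intro v _ hv
    rw [hubNbr_of_notMem_range f l J (by simpa using hv)]
    simpa using hg

theorem exists_getElem?_hubNbr_eq (l : List K) (v : Fin n) (m : ℕ) :
    ∃ j, ∀ J : Finset K, j ∉ J → (hubNbr f l J v)[m]? = (hubNbr f l ∅ v)[m]? := by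
  by_cases hv : ∃ x, f x = v
  · obtain ⟨x, rfl⟩ := hv
    obtain ⟨j, hj⟩ := exists_getElem?_hubList_eq l x m
    exact ⟨j, fun J hJ => by simp only [hubNbr_apply, List.getElem?_map, hj J hJ]⟩
  · exact ⟨0, fun J _ => by simp only [hubNbr_of_notMem_range f l _ hv]⟩

theorem exists_length_hubNbr_eq (l : List K) (v : Fin n) :
    ∃ j, ∀ J : Finset K, j ∉ J → (hubNbr f l J v).length = (hubNbr f l ∅ v).length := by
  by_cases hv : ∃ x, f x = v
  · obtain ⟨x, rfl⟩ := hv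
    obtain ⟨j, hj⟩ := exists_length_hubList_eq l x
    exact ⟨j, fun J hJ => by simp only [hubNbr_apply, List.length_map, hj J hJ]⟩
  · exact ⟨0, fun J _ => by simp only [hubNbr_of_notMem_range f l _ hv]⟩

variable {l : List K} (hl : l.Nodup) {J : Finset K} (hJ : ∀ j ∈ J, j ∈ l)

theorem starCount_hubAdj {p : ℕ} (hp : p ≠ 0) :
    starCount (hubAdj f hl hJ).graph p =
      2 * Fintype.card K * l.length.choose p + J.card * (2 * Fintype.card K).choose p := by
  rw [AdjList.starCount_eq]
  exact sum_length_hubNbr f l J (g := fun d => d.choose p) (Nat.choose_eq_zero_of_lt (by lia))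

theorem card_edges_hubAdj :
    (hubAdj f hl hJ).graph.edgeSet.toFinite.toFinset.card =
      Fintype.card K * l.length + J.card * Fintype.card K := by
  have h := (hubAdj f hl hJ).two_mul_card_edges
  have h' := sum_length_hubNbr f l J (g := id) rfl
  simp only [id] at h'
  rw [show (hubAdj f hl hJ).nbr = hubNbr f l J from rfl, h'] at h
  linarith

theorem card_edges_sdiff_le [DecidableEq (Sym2 (Fin n))] (h₀ : ∀ j ∈ (∅ : Finset K), j ∈ l) :
    ((hubAdj f hl hJ).graph.edgeSet.toFinite.toFinset \
      (hubAdj f hl h₀).graph.edgeSet.toFinite.toFinset).card ≤ J.card * (2 * Fintype.card K) := by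
  have hsub : (hubAdj f hl hJ).graph.edgeSet.toFinite.toFinset \
      (hubAdj f hl h₀).graph.edgeSet.toFinite.toFinset ⊆
      (J ×ˢ (Finset.univ : Finset (K ⊕ K))).image fun x =>
        s(f (.inr (.inr x.1)), f ((Equiv.sumAssoc K K K) (.inl x.2))) := by
    intro e
    induction e with
    | _ v w =>
      simp only [Finset.mem_sdiff, Set.Finite.mem_toFinset, SimpleGraph.mem_edgeSet]
      rintro ⟨h, h'⟩
      obtain ⟨x, y, rfl, rfl, hxy⟩ := (mem_hubNbr f).1 h
      have hn : y ∉ hubList l ∅ x := fun hy => h' ((mem_hubNbr f).2 ⟨x, y, rfl, rfl, hy⟩)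
      obtain ⟨j, hj, i, hji⟩ := hub_of_mem_of_notMem hxy hn
      refine Finset.mem_image.2 ⟨(j, i), by simpa using hj, ?_⟩
      simpa using (congrArg (Sym2.map f) hji).symm
  refine (Finset.card_le_card hsub).trans (Finset.card_image_le.trans ?_)
  simp [two_mul]

end Hub

/-! ### Query bound for hidden hubs. -/

/-- By disjointness `j` lies in at most one `J t`, the only term that can be nonzero. -/
theorem sum_ite_le_one {K ι : Type*} [Fintype ι] {J : ι → Finset K}
    (hJ : Pairwise fun t t' => Disjoint (J t) (J t')) (j : K) (P : ι → Prop) [DecidablePred P]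
    (h : ∀ t, j ∉ J t → P t) : ∑ t, (if P t then 0 else 1 : ℝ≥0∞) ≤ 1 := by
  classical
  by_cases hj : ∃ t, j ∈ J t
  · obtain ⟨t, ht⟩ := hj
    rw [Finset.sum_eq_single t]
    · split_ifs <;> simp
    · intro t' _ htt'
      exact if_pos (h t' fun ht' => Finset.disjoint_left.1 (hJ htt') ht' ht)
    · simp
  · simp [fun t => h t fun ht => hj ⟨t, ht⟩]

/-- An algorithm telling the graph without hubs from the graphs with `k` hubs hidden at one of `T`
disjoint sets of positions makes `Ω(T)` queries. -/
theorem le_six_mul_queries {n N T k p : ℕ} (hn : 3 * N ≤ n) (hN : T * k ≤ N) (hT : T ≠ 0)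
    (hk : k ≠ 0) (hp : p ≠ 0) {α : ℝ} {Ω : Type*} [MeasurableSpace Ω] (μ : Measure Ω)
    [IsProbabilityMeasure μ] (A : Ω → DetAlg n) (q S₁ S₂ : ℕ)
    (hS₁ : S₁ = 2 * N * (T * k).choose p) (hS₂ : S₂ = S₁ + k * (2 * N).choose p)
    (hS : α * S₁ < S₂ / α)
    (hA : ∀ L : AdjList n, starCount L.graph p = S₁ ∨ starCount L.graph p = S₂ →
      2 / 3 ≤ successProb μ A q p α L) :
    T ≤ 6 * q := by
  classical
  have hTk : 0 < T * k := by positivity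
  have : NeZero N := ⟨by lia⟩
  obtain ⟨f⟩ : Nonempty (Fin N ⊕ Fin N ⊕ Fin N ↪ Fin n) :=
    Function.Embedding.nonempty_of_card_le (by simp; lia)
  obtain ⟨g⟩ : Nonempty (Fin T × Fin k ↪ Fin N) :=
    Function.Embedding.nonempty_of_card_le (by simpa using hN)
  set l : List (Fin N) := (Finset.univ.map g).toList with hl_def
  have hl : l.Nodup := Finset.nodup_toList _
  have hlen : l.length = T * k := by simp [hl_def]
  set J : Fin T → Finset (Fin N) := fun t => Finset.univ.image fun i => g (t, i) with hJ_def
  have hJl : ∀ t, ∀ j ∈ J t, j ∈ l := by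
    intro t j hj
    obtain ⟨i, -, rfl⟩ := Finset.mem_image.1 hj
    simp [hl_def]
  have hJcard : ∀ t, (J t).card = k := by
    intro t
    rw [hJ_def, Finset.card_image_of_injective _ fun i i' h => by simpa using h]
    simp
  have hJdisj : Pairwise fun t t' => Disjoint (J t) (J t') := by
    intro t t' htt'
    rw [Finset.disjoint_left]
    intro j hj hj'
    obtain ⟨i, -, rfl⟩ := Finset.mem_image.1 hj
    obtain ⟨i', -, h⟩ := Finset.mem_image.1 hj'
    simp only [EmbeddingLike.apply_eq_iff_eq, Prod.mk.injEq] at h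
    exact htt' h.1.symm
  have hJ₀ : ∀ j ∈ (∅ : Finset (Fin N)), j ∈ l := by simp
  set L₁ := hubAdj f hl hJ₀ with hL₁
  set L₂ : Fin T → AdjList n := fun t => hubAdj f hl (hJl t) with hL₂
  have hc₁ : starCount L₁.graph p = S₁ := by
    rw [hL₁, starCount_hubAdj f hl _ hp, hlen, hS₁]
    simp
  have hc₂ : ∀ t, starCount (L₂ t).graph p = S₂ := by
    intro t
    rw [hL₂, starCount_hubAdj f hl _ hp, hlen, hJcard, hS₂, hS₁]
    simp
  have hE₁ : L₁.graph.edgeSet.toFinite.toFinset.card = N * (T * k) := by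
    rw [hL₁, card_edges_hubAdj, hlen]
    simp
  have hE₂ : ∀ t, (L₂ t).graph.edgeSet.toFinite.toFinset.card = N * (T * k) + k * N := by
    intro t
    rw [hL₂, card_edges_hubAdj, hlen, hJcard]
    simp
  -- At most `2 * k * N` of the `(T + 1) * k * N` edges are new.
  have hE : ∀ t, (((L₂ t).graph.edgeSet.toFinite.toFinset \
      L₁.graph.edgeSet.toFinite.toFinset).card : ℝ≥0∞) /
        (L₂ t).graph.edgeSet.toFinite.toFinset.card ≤ 2 / T := by
    intro t
    have h := card_edges_sdiff_le f hl (hJl t) hJ₀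
    rw [hJcard, Fintype.card_fin] at h
    have hT' : (T : ℝ≥0∞) ≠ 0 := by exact_mod_cast hT
    rw [hE₂]
    refine ENNReal.div_le_of_le_mul ?_
    rw [ENNReal.mul_comm_div, ← mul_div_assoc, ENNReal.le_div_iff_mul_le (.inl hT')
      (.inl (by finiteness))]
    norm_cast
    calc _ ≤ k * (2 * N) * T := Nat.mul_le_mul_right _ h
      _ ≤ 2 * (N * (T * k) + k * N) := by nlinarith [Nat.zero_le (k * N)]
  have key := card_le_of_success μ A q p α L₁ L₂
    (fun Q t => AdjList.advantage L₁ (L₂ t) (2 / T) Q)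
    (fun Q t h hh => AdjList.tsum_answer_mul_le L₁ (L₂ t) rfl rfl
      (Finset.card_pos.1 (by rw [hE₁]; have := NeZero.pos N; positivity))
      (by rw [hE₁, hE₂]; lia) (hE t) Q h hh)
    (fun Q => by
      cases Q with
      | neighbor v i =>
        obtain ⟨j, hj⟩ := exists_getElem?_hubNbr_eq f l v i
        exact (sum_ite_le_one hJdisj j _ fun t ht => hj _ ht).trans one_le_two
      | degree v =>
        obtain ⟨j, hj⟩ := exists_length_hubNbr_eq f l v
        exact (sum_ite_le_one hJdisj j _ fun t ht => hj _ ht).trans one_le_two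
      | randomEdge =>
        simp only [AdjList.advantage, Finset.sum_const, Finset.card_univ, Fintype.card_fin,
          nsmul_eq_mul]
        exact ENNReal.mul_div_le)
    S₂ hc₂ (by rwa [hc₁]) (hA _ (.inl hc₁)) fun t => hA _ (.inr (hc₂ t))
  simpa using key

/-! ### Choice of parameters. -/

open Nat in
theorem pow_div_factorial_le_choose {D p : ℕ} (h : 2 * p ≤ D) {x : ℝ} (hx : 0 ≤ x)
    (hxD : 2 * x ≤ D) : x ^ p / p ! ≤ D.choose p := by
  refine le_trans ?_ (Nat.pow_le_choose p D)
  have h' : x ≤ (D + 1 - p : ℕ) := by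
    rw [Nat.cast_sub (by lia)]
    have : (2 * p : ℝ) ≤ D := by exact_mod_cast h
    push_cast
    linarith
  gcongr

open Nat in
/-- The choice of the number `T` of positions and of the number `k` of hubs. -/
theorem exists_parameters {p : ℕ} (hp : 2 ≤ p) {α κ M δ d s σ : ℝ} (hα : 1 ≤ α) (hκ : 0 < κ)
    (hM : M = α ^ 2 * (4 ^ p * p !)) (hδ : δ = 1 / (2 * M)) {n : ℕ} (hn : 8 ≤ n) (hnp : 4 * p ≤ n)
    (hd : 8 * p * M ≤ d) (hdn : d ≤ n) (hs : s = n * d ^ p) (hσ : σ = s / (n : ℝ) ^ p)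
    (hκσ : κ ≤ σ) :
    ∃ N T k S₁ S₂ : ℕ, 3 * N ≤ n ∧ T * k ≤ N ∧ T ≠ 0 ∧ k ≠ 0 ∧
      S₁ = 2 * N * (T * k).choose p ∧ S₂ = S₁ + k * (2 * N).choose p ∧
      δ ^ p / (2 * (4 ^ p * p !)) * s ≤ S₁ ∧ (S₂ : ℝ) ≤ (1 + M + 1 / κ) * s ∧ α * S₁ < S₂ / α ∧
      δ * d ≤ 2 * (T * ((M + 1 / κ) * σ)) := by
  have hn0 : (0 : ℝ) < n := by exact_mod_cast (by lia : 0 < n)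
  have hp2 : (2 : ℝ) ≤ p := by exact_mod_cast hp
  have hF : (2 : ℝ) ≤ p ! := hp2.trans (by exact_mod_cast Nat.self_le_factorial p)
  have hM32 : 32 ≤ M := by
    have h4 : (4 : ℝ) ^ 2 ≤ 4 ^ p := pow_le_pow_right₀ (by norm_num) hp
    have : (1 : ℝ) ≤ α ^ 2 := one_le_pow₀ hα
    calc (32 : ℝ) = 1 * (4 ^ 2 * 2) := by norm_num
      _ ≤ M := by rw [hM]; gcongr
  have hδ0 : 0 < δ := by rw [hδ]; positivity
  have hMδ : M * δ = 1 / 2 := by rw [hδ]; field_simp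
  have hδ64 : δ ≤ 1 / 64 := by nlinarith
  have hd0 : 0 < d := lt_of_lt_of_le (by positivity) hd
  have hs0 : 0 < s := by rw [hs]; positivity
  have hσ0 : 0 < σ := hκ.trans_le hκσ
  have hσn : σ * (n : ℝ) ^ p = s := by rw [hσ]; field_simp
  have hδd : 4 * p ≤ δ * d := by nlinarith
  have hδp1 : δ ^ p ≤ 1 := pow_le_one₀ hδ0.le (by linarith)
  -- Indeed `σ = d * (d/n)^(p-1)` and `d ≤ n`.
  have hσd : σ ≤ d := by
    rw [hσ, div_le_iff₀ (by positivity), hs]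
    obtain ⟨m, rfl⟩ : ∃ m, p = m + 1 := ⟨p - 1, by lia⟩
    have : d ^ m ≤ (n : ℝ) ^ m := by gcongr
    calc (n : ℝ) * d ^ (m + 1) = d * n * d ^ m := by ring
      _ ≤ d * n * (n : ℝ) ^ m := by gcongr
      _ = d * (n : ℝ) ^ (m + 1) := by ring
  -- Since `p ≥ 2`, the choice `M * δ = 1/2` leaves room for `k` differences among `δ * d`, even
  -- after rounding up.
  have hx : M * δ ^ p * σ ≤ δ * d / 2 := by
    have : δ ^ p ≤ δ ^ 2 := pow_le_pow_of_le_one hδ0.le (by linarith) hp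
    calc M * δ ^ p * σ ≤ M * δ ^ 2 * d := by gcongr
      _ = M * δ * (δ * d) := by ring
      _ = δ * d / 2 := by rw [hMδ]; ring
  have hx0 : 0 < M * δ ^ p * σ := by positivity
  set k := ⌈M * δ ^ p * σ⌉₊ with hk_def
  have hk : 0 < k := Nat.ceil_pos.2 hx0
  have hk0 : (0 : ℝ) < k := by exact_mod_cast hk
  have hk1 : M * δ ^ p * σ ≤ k := Nat.le_ceil _
  have hk2 : (k : ℝ) ≤ M * δ ^ p * σ + 1 := (Nat.ceil_lt_add_one hx0.le).le
  have hkd : (k : ℝ) ≤ δ * d := by linarith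
  set T := ⌊δ * d / k⌋₊ with hT_def
  have hT : 0 < T := Nat.floor_pos.2 ((one_le_div hk0).2 hkd)
  have hT1 : (1 : ℝ) ≤ T := by exact_mod_cast hT
  have hTk : (T * k : ℝ) ≤ δ * d := (le_div_iff₀ hk0).1 (Nat.floor_le (by positivity))
  -- Rounding down a number that is at least 1 loses at most a factor 2.
  have hTk' : δ * d ≤ 2 * (T * k) := by
    have := (div_lt_iff₀ hk0).1 (Nat.lt_floor_add_one (δ * d / k))
    rw [← hT_def] at this
    nlinarith
  have hN3 : 3 * (n / 3) ≤ n := by lia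
  have hN4 : (n : ℝ) ≤ 4 * (n / 3 : ℕ) := by exact_mod_cast (by lia : n ≤ 4 * (n / 3))
  have hN2 : (2 * (n / 3 : ℕ) : ℝ) ≤ n := by exact_mod_cast (by lia : 2 * (n / 3) ≤ n)
  set N := n / 3
  set S₁ := 2 * N * (T * k).choose p with hS₁
  have hlow : δ ^ p / (2 * (4 ^ p * p !)) * s ≤ S₁ := by
    have h2p : 2 * p ≤ T * k := by
      have : (2 * p : ℝ) ≤ T * k := by linarith
      exact_mod_cast this
    have h := pow_div_factorial_le_choose h2p (x := δ * d / 4) (by positivity)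
      (by push_cast; linarith)
    calc δ ^ p / (2 * (4 ^ p * p !)) * s = n / 2 * ((δ * d / 4) ^ p / p !) := by
          rw [hs, div_pow, mul_pow]
          field_simp
      _ ≤ 2 * N * (T * k).choose p := by gcongr; linarith
      _ = S₁ := by simp [hS₁]
  have hS₁0 : (0 : ℝ) < S₁ := lt_of_lt_of_le (by positivity) hlow
  have hup : (S₁ : ℝ) ≤ δ ^ p * s := by
    calc (S₁ : ℝ) = 2 * N * (T * k).choose p := by simp [hS₁]
      _ ≤ n * (T * k : ℝ) ^ p := by
          gcongr
          exact_mod_cast Nat.choose_le_pow (T * k) p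
      _ ≤ n * (δ * d) ^ p := by gcongr
      _ = δ ^ p * s := by rw [hs, mul_pow]; ring
  -- The factor `4 ^ p * p !` in `M` pays for `(2 * N).choose p ≥ (n/4)^p / p !`.
  have hhub : α ^ 2 * (δ ^ p * s) ≤ k * (2 * N).choose p := by
    have h := pow_div_factorial_le_choose (D := 2 * N) (p := p) (by lia) (x := n / 4)
      (by positivity) (by push_cast; linarith)
    calc α ^ 2 * (δ ^ p * s) = M * δ ^ p * σ * ((n / 4 : ℝ) ^ p / p !) := by
          rw [← hσn, hM, div_pow]
          field_simp
      _ ≤ k * (2 * N).choose p := by gcongr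
  -- The lower bound on `σ` absorbs the 1 lost in rounding `k` up.
  have hone : 1 ≤ 1 / κ * σ := by
    rw [one_div, ← div_eq_inv_mul]
    exact (one_le_div hκ).2 hκσ
  have hkσ : (k : ℝ) ≤ (M + 1 / κ) * σ := by
    have : M * δ ^ p * σ ≤ M * 1 * σ := by gcongr
    linarith
  refine ⟨N, T, k, S₁, S₁ + k * (2 * N).choose p, hN3, ?_, hT.ne', hk.ne', rfl, rfl, hlow, ?_, ?_,
    ?_⟩
  · have : (T * k : ℝ) ≤ N := by nlinarith
    exact_mod_cast this
  · push_cast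
    have h1 : (S₁ : ℝ) ≤ 1 * s := hup.trans (by gcongr)
    have h2 : (k * (2 * N).choose p : ℝ) ≤ (M + 1 / κ) * σ * (n : ℝ) ^ p := by
      gcongr
      refine le_trans (by exact_mod_cast Nat.choose_le_pow (2 * N) p) (?_ : (2 * N : ℝ) ^ p ≤ _)
      gcongr
    rw [mul_assoc, hσn] at h2
    linarith
  · rw [lt_div_iff₀ (by linarith)]
    push_cast
    have : α ^ 2 * S₁ ≤ α ^ 2 * (δ ^ p * s) := by gcongr
    linarith
  · exact hTk'.trans (by gcongr)

theorem rpow_bound_eq (p : ℕ) {n s : ℝ} (hn : 0 < n) (hs : 0 < s) :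
    n ^ ((p : ℝ) - 1 / (p : ℝ)) / s ^ (1 - 1 / (p : ℝ)) =
      (s / n) ^ (1 / (p : ℝ)) / (s / n ^ p) := by
  rw [Real.rpow_sub hn, Real.rpow_sub hs, Real.rpow_natCast, Real.rpow_one,
    Real.div_rpow hs.le hn.le]
  have := (Real.rpow_pos_of_pos hn (1 / (p : ℝ))).ne'
  have := (Real.rpow_pos_of_pos hs (1 / (p : ℝ))).ne'
  field_simp

end StarCount

open StarCount Nat in
theorem mainTheorem5 (p : ℕ) (hp : 2 ≤ p) (α : ℝ) (hα : 1 ≤ α) (κ : ℝ) (hκ : 0 < κ) :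
    ∃ (C c : ℝ) (n₀ : ℕ), 1 ≤ C ∧ 0 < c ∧
      ∀ n : ℕ, n₀ ≤ n →
      ∀ s : ℝ, κ * (n : ℝ) ^ p ≤ s → s ≤ ((n * (n - 1).choose p : ℕ) : ℝ) →
      ∀ (Ω : Type*) [MeasurableSpace Ω] (μ : Measure Ω) [IsProbabilityMeasure μ]
        (A : Ω → StarCount.DetAlg n) (q : ℕ),
        (∀ L : StarCount.AdjList n,
          s / C ≤ (StarCount.starCount L.graph p : ℝ) →
          (StarCount.starCount L.graph p : ℝ) ≤ C * s →
          2 / 3 ≤ StarCount.successProb μ A q p α L) →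
        c * ((n : ℝ) ^ ((p : ℝ) - 1 / (p : ℝ)) / s ^ (1 - 1 / (p : ℝ))) ≤ (q : ℝ) := by
  obtain ⟨M, hM⟩ : ∃ M : ℝ, M = α ^ 2 * (4 ^ p * p !) := ⟨_, rfl⟩
  obtain ⟨δ, hδ⟩ : ∃ δ : ℝ, δ = 1 / (2 * M) := ⟨_, rfl⟩
  have hM0 : 0 < M := by rw [hM]; positivity
  have hδ0 : 0 < δ := by rw [hδ]; positivity
  obtain ⟨B, hB⟩ : ∃ B : ℝ, B = δ ^ p / (2 * (4 ^ p * p !)) := ⟨_, rfl⟩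
  have hB0 : 0 < B := by rw [hB]; positivity
  have hC : 1 + M + 1 / κ ≤ 1 + M + 1 / κ + B⁻¹ := le_add_of_nonneg_right (by positivity)
  -- The summand `B⁻¹` covers the lower end of the range of `S_p`, the others the upper end. The 12
  -- is 6 from `T ≤ 6 * q` times 2 from rounding `T`. Through `d ^ p = s/n ≥ κ * n`, the ceiling
  -- ensures `d ≥ 8 * p * M`.
  refine ⟨1 + M + 1 / κ + B⁻¹, δ / (12 * (M + 1 / κ)), ⌈(8 * p * M) ^ p / κ⌉₊ + 8 + 4 * p, ?_,
    by positivity, ?_⟩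
  · have : 0 < 1 / κ := by positivity
    linarith
  intro n hn s hs₁ hs₂ Ω _ μ _ A q hA
  have hn0 : (0 : ℝ) < n := by exact_mod_cast (by lia : 0 < n)
  have hn1 : (1 : ℝ) ≤ n := by exact_mod_cast (by lia : 1 ≤ n)
  have hs0 : 0 < s := lt_of_lt_of_le (by positivity) hs₁
  obtain ⟨d, hd⟩ : ∃ d : ℝ, d = (s / n) ^ (1 / (p : ℝ)) := ⟨_, rfl⟩
  obtain ⟨σ, hσ⟩ : ∃ σ : ℝ, σ = s / (n : ℝ) ^ p := ⟨_, rfl⟩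
  have hd0 : 0 ≤ d := by rw [hd]; positivity
  have hdp : d ^ p = s / n := by
    rw [hd, one_div]
    exact Real.rpow_inv_natCast_pow (by positivity) (by lia)
  have hp0 : p ≠ 0 := by lia
  have hdn : d ≤ n := by
    refine le_of_pow_le_pow_left₀ hp0 hn0.le ?_
    rw [hdp, div_le_iff₀ hn0, mul_comm]
    refine hs₂.trans ?_
    push_cast
    gcongr
    exact_mod_cast (Nat.choose_le_pow _ _).trans (Nat.pow_le_pow_left (Nat.sub_le n 1) p)
  have hdM : 8 * p * M ≤ d := by
    refine le_of_pow_le_pow_left₀ hp0 hd0 ?_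
    rw [hdp, le_div_iff₀ hn0]
    have hn' : (8 * p * M) ^ p / κ ≤ n :=
      (Nat.le_ceil _).trans (by exact_mod_cast (by lia : ⌈(8 * p * M) ^ p / κ⌉₊ ≤ n))
    calc (8 * p * M) ^ p * n ≤ n * κ * n := by
          gcongr
          exact (div_le_iff₀ hκ).1 hn'
      _ = κ * (n : ℝ) ^ 2 := by ring
      _ ≤ κ * (n : ℝ) ^ p := by gcongr
      _ ≤ s := hs₁
  have hκσ : κ ≤ σ := by rwa [hσ, le_div_iff₀ (by positivity)]
  have hσ0 : 0 < σ := hκ.trans_le hκσ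
  obtain ⟨N, T, k, S₁, S₂, hN, hTk, hT, hk, hS₁, hS₂, hlow, hup, hS, hfin⟩ :=
    exists_parameters hp hα hκ hM hδ (by lia : 8 ≤ n) (by lia) hdM hdn
      (by rw [hdp]; field_simp) hσ hκσ
  rw [← hB] at hlow
  have hS₁₂ : (S₁ : ℝ) ≤ S₂ := by exact_mod_cast hS₂ ▸ Nat.le_add_right _ _
  have hrange : ∀ S : ℝ, S₁ ≤ S → S ≤ S₂ →
      s / (1 + M + 1 / κ + B⁻¹) ≤ S ∧ S ≤ (1 + M + 1 / κ + B⁻¹) * s := by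
    refine fun S h₁ h₂ => ⟨le_trans ?_ (hlow.trans h₁), h₂.trans (hup.trans (by gcongr))⟩
    calc s / (1 + M + 1 / κ + B⁻¹) ≤ s / B⁻¹ := by
          gcongr
          exact le_add_of_nonneg_left (by positivity)
      _ = B * s := by field_simp
  have key := le_six_mul_queries hN hTk hT hk hp0 μ A q S₁ S₂ hS₁ hS₂ hS fun L hL => by
    have := hrange (starCount L.graph p) (by rcases hL with h | h <;> simp [h, hS₁₂])
      (by rcases hL with h | h <;> simp [h, hS₁₂])
    exact hA L this.1 this.2
  have key' : (T : ℝ) ≤ 6 * q := by exact_mod_cast key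
  rw [rpow_bound_eq p hn0 hs0, ← hd, ← hσ]
  have hMκ : 0 < M + 1 / κ := by positivity
  rw [_root_.div_mul_div_comm, div_le_iff₀ (by positivity)]
  refine hfin.trans ?_
  have : (T : ℝ) * ((M + 1 / κ) * σ) ≤ 6 * q * ((M + 1 / κ) * σ) := by gcongr
  linarith
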